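/- Let $m,p,N\in\mathbb{N}$, let $\sigma>0$, and let $\mathcal{D}$ be the set of matrices in $\mathbb{R}^{m\times p}$ all of whose columns have Euclidean norm $1$. Fix $\mathbf{D}_0\in\mathcal{D}$ and a radius $0<r\le 2\sqrt{p}$, and put $\mathcal{X}(\mathbf{D}_0,r)=\{\mathbf{D}\in\mathcal{D}:\|\mathbf{D}-\mathbf{D}_0\|_{\rm F}<r\}$, where $\|\mathbf{A}\|_{\rm F}=\sqrt{\operatorname{tr}(\mathbf{A}\mathbf{A}^{T})}$. Let $P_x$ be a probability distribution on $\mathbb{R}^p$ with mean zero and finite second moments, and let $\mathbf{\Sigma}_x=\mathrm{E}\{\mathbf{x}\mathbf{x}^T\}$ for $\mathbf{x}\sim P_x$. For $\mathbf{D}\in\mathcal{X}(\mathbf{D}_0,r)$, the data $\mathbf{Y}=(\mathbf{y}_1,\dots,\mathbf{y}_N)$ consist of $N$ i.i.d. copies of $\mathbf{y}=\mathbf{D}\mathbf{x}+\mathbf{n}$, where $\mathbf{x}\sim P_x$ and the noise $\mathbf{n}\sim\mathcal{N}(\mathbf{0},\sigma^2\mathbf{I}_m)$ is independent of $\mathbf{x}$.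 Define the minimax risk $$\varepsilon^*=\inf_{\widehat{\mathbf{D}}}\ \sup_{\mathbf{D}\in\mathcal{X}(\mathbf{D}_0,r)}\mathrm{E}_{\mathbf{Y}}\big\{\|\widehat{\mathbf{D}}(\mathbf{Y})-\mathbf{D}\|_{\rm F}^2\big\},$$ where the infimum is over all measurable maps $\widehat{\mathbf{D}}:(\mathbb{R}^m)^N\to\mathbb{R}^{m\times p}$. If $p(m-1)\ge 50$, then $$\varepsilon^*\ \ge\ \frac{1}{320}\min\Big\{r^2,\ \frac{\sigma^2}{N\|\mathbf{\Sigma}_x\|_2}\Big(\frac{p(m-1)}{10}-1\Big)\Big\},$$ where $\|\cdot\|_2$ is the spectral norm and the second term of the minimum is read as $+\infty$ if $N\|\mathbf{\Sigma}_x\|_2=0$. -/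

import Mathlib

namespace DictLearn

open MeasureTheory ProbabilityTheory
open scoped ENNReal Matrix

/-- The Frobenius norm `‖A‖_F = √(tr (A Aᵀ))`. -/
noncomputable def frobNorm {m p : ℕ} (A : Matrix (Fin m) (Fin p) ℝ) : ℝ :=
  √(Matrix.trace (A * Aᵀ))

/-- The spectral norm `‖A‖₂`: the operator norm with respect to the Euclidean norm. -/
noncomputable def specNorm {p : ℕ} (A : Matrix (Fin p) (Fin p) ℝ) : ℝ :=
  ‖Matrix.toEuclideanCLM (n := Fin p) (𝕜 := ℝ) A‖

/-- The dictionaries: the `m × p` matrices all of whose columns have Euclidean norm one. -/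
def dictionaries (m p : ℕ) : Set (Matrix (Fin m) (Fin p) ℝ) :=
  {B | ∀ k, (Bᵀ * B) k k = 1}

/-- The dictionaries at Frobenius distance less than `r` from `D₀`. -/
def localDictionaries {m p : ℕ} (D₀ : Matrix (Fin m) (Fin p) ℝ) (r : ℝ) :
    Set (Matrix (Fin m) (Fin p) ℝ) :=
  {D | D ∈ dictionaries m p ∧ frobNorm (D - D₀) < r}

/-- The covariance matrix `E[x xᵀ]` of a zero-mean random vector `x` with law `P`. -/
noncomputable def covMat {p : ℕ} (P : Measure (Fin p → ℝ)) : Matrix (Fin p) (Fin p) ℝ :=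
  Matrix.of fun i j => ∫ x, x i * x j ∂P

/-- White Gaussian noise in `ℝᵐ`: independent coordinates with law `N(0, σ²)`. -/
noncomputable def whiteNoise (m : ℕ) (σ : ℝ) : Measure (Fin m → ℝ) :=
  Measure.pi fun _ => gaussianReal 0 (Real.toNNReal (σ ^ 2))

/-- The law of one observation `y = D x + n`, where `x ∼ P` and the white Gaussian noise `n` are
independent. -/
noncomputable def obsLaw {m p : ℕ} (P : Measure (Fin p → ℝ)) (σ : ℝ)
    (D : Matrix (Fin m) (Fin p) ℝ) : Measure (Fin m → ℝ) :=
  (P.prod (whiteNoise m σ)).map fun xn => D *ᵥ xn.1 + xn.2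

/-- The law of the data `Y = (y₁, …, y_N)`: `N` i.i.d. observations. -/
noncomputable def dataLaw {m p : ℕ} (N : ℕ) (P : Measure (Fin p → ℝ)) (σ : ℝ)
    (D : Matrix (Fin m) (Fin p) ℝ) : Measure (Fin N → Fin m → ℝ) :=
  Measure.pi fun _ => obsLaw P σ D

/-- The mean squared error `E ‖Dhat(Y) - D‖_F²` when `D` is the true dictionary. -/
noncomputable def mse {m p : ℕ} (N : ℕ) (P : Measure (Fin p → ℝ)) (σ : ℝ)
    (Dhat : (Fin N → Fin m → ℝ) → Matrix (Fin m) (Fin p) ℝ)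
    (D : Matrix (Fin m) (Fin p) ℝ) : ℝ≥0∞ :=
  ∫⁻ Y, ENNReal.ofReal (frobNorm (Dhat Y - D) ^ 2) ∂(dataLaw N P σ D)

/-- The minimax risk: the infimum over all (measurable) estimators of the worst-case mean squared
error over the dictionaries at distance less than `r` from `D₀`. -/
noncomputable def minimaxRisk {m p : ℕ} (N : ℕ) (P : Measure (Fin p → ℝ)) (σ : ℝ)
    (D₀ : Matrix (Fin m) (Fin p) ℝ) (r : ℝ) : ℝ≥0∞ :=
  ⨅ (Dhat : (Fin N → Fin m → ℝ) → Matrix (Fin m) (Fin p) ℝ)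
    (_ : ∀ i j, Measurable fun Y => Dhat Y i j),
    ⨆ D ∈ localDictionaries D₀ r, mse N P σ Dhat D

end DictLearn

namespace DictLearn

open MeasureTheory ProbabilityTheory
open scoped ENNReal Matrix

/-! The argument is Assouad's, with squared error handled directly instead of through information
inequalities. Write `m = n + 1`. Each column of `D₀` is completed to an orthonormal basis, and a
vertex of a `p * n`-dimensional cube moves the column by `±a` along each of the `n` new directions,
its component along the old column being shrunk to keep unit length. By Parseval the Frobenius loss
dominates the sum of the squared errors in these coordinates, so it suffices that flipping one bit
costs a total of `a ^ 2` in its own coordinate (`two_point_dataLaw`); averaging over the cube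
(`card_mul_le_two_mul_sum_cube`) then gives risk at least `p * n * a ^ 2 / 2`.

For one bit, fix the coefficients. The two data laws are then translates by `±w` of white noise
around a common centre, and the product of their likelihood ratios is the constant `exp (-‖w‖² /
σ²)`. This gives a two-point bound (`two_point_dataNoise`), and averaging over the coefficients
needs only the mean of `‖w‖²`, hence only second moments. -/

/-! ### Product measures with densities -/

/-- The integral of a product of functions of separate coordinates is the product of the
integrals. -/
lemma lintegral_pi_prod {ι : Type*} [Fintype ι] {E : ι → Type*} [∀ i, MeasurableSpace (E i)]
    (μ : ∀ i, Measure (E i)) [∀ i, IsProbabilityMeasure (μ i)] (f : ∀ i, E i → ℝ≥0∞)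
    (hf : ∀ i, Measurable (f i)) :
    ∫⁻ x, ∏ i, f i (x i) ∂(Measure.pi μ) = ∏ i, ∫⁻ x, f i x ∂(μ i) := by
  rw [lintegral_prod_eq_prod_lintegral_of_indepFun Finset.univ (fun i (x : ∀ i, E i) => f i (x i))
    (iIndepFun_pi fun i => (hf i).aemeasurable) fun i => (hf i).comp (measurable_pi_apply i)]
  exact Finset.prod_congr rfl fun i _ => (measurePreserving_eval μ i).lintegral_comp (hf i)

/-- A product of measures with densities has the product density. -/
lemma pi_withDensity {ι : Type*} [Fintype ι] {E : ι → Type*} [∀ i, MeasurableSpace (E i)]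
    (μ : ∀ i, Measure (E i)) [∀ i, IsProbabilityMeasure (μ i)] (f : ∀ i, E i → ℝ≥0∞)
    (hf : ∀ i, Measurable (f i)) [∀ i, SigmaFinite ((μ i).withDensity (f i))] :
    Measure.pi (fun i => (μ i).withDensity (f i)) =
      (Measure.pi μ).withDensity fun x => ∏ i, f i (x i) := by
  refine Measure.pi_eq fun s hs => ?_
  rw [withDensity_apply _ (MeasurableSet.univ_pi hs),
    ← lintegral_indicator (MeasurableSet.univ_pi hs)]
  have key : (Set.univ.pi s).indicator (fun x : ∀ i, E i => ∏ i, f i (x i)) =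
      fun x => ∏ i, (s i).indicator (f i) (x i) := by
    classical
    ext x
    by_cases hx : x ∈ Set.univ.pi s
    · rw [Set.indicator_of_mem hx]
      exact Finset.prod_congr rfl fun i _ =>
        (Set.indicator_of_mem (hx i (Set.mem_univ i)) _).symm
    · rw [Set.indicator_of_notMem hx]
      simp only [Set.mem_pi, Set.mem_univ, forall_const, not_forall] at hx
      obtain ⟨i, hi⟩ := hx
      exact (Finset.prod_eq_zero (Finset.mem_univ i) (Set.indicator_of_notMem hi _)).symm
  rw [key, lintegral_pi_prod μ _ fun i => (hf i).indicator (hs i)]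
  exact Finset.prod_congr rfl fun i _ => by
    rw [lintegral_indicator (hs i), withDensity_apply _ (hs i)]

/-- If the translates of the factors have densities with respect to the factors, then the
translate of the product measure has the product density. -/
lemma map_add_pi {ι : Type*} [Fintype ι] {E : ι → Type*} [∀ i, MeasurableSpace (E i)]
    [∀ i, Add (E i)] [∀ i, MeasurableAdd (E i)]
    (μ : ∀ i, Measure (E i)) [∀ i, IsProbabilityMeasure (μ i)] (w : ∀ i, E i)
    (f : ∀ i, E i → ℝ≥0∞) (hf : ∀ i, Measurable (f i))
    (h : ∀ i, (μ i).map (fun y => w i + y) = (μ i).withDensity (f i)) :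
    (Measure.pi μ).map (fun y => w + y) =
      (Measure.pi μ).withDensity fun x => ∏ i, f i (x i) := by
  have hprob : ∀ i, IsProbabilityMeasure ((μ i).map fun y => w i + y) := fun i =>
    Measure.isProbabilityMeasure_map (measurable_const_add (w i)).aemeasurable
  have hprob' : ∀ i, IsProbabilityMeasure ((μ i).withDensity (f i)) := fun i => h i ▸ hprob i
  rw [← pi_withDensity μ f hf]
  have := Measure.pi_map_pi (μ := μ) (f := fun i y => w i + y)
    fun i => (measurable_const_add (w i)).aemeasurable
  simp only [h] at this
  exact this

/-! ### Translates of Gaussian white noise -/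

/-- The density of a translate of a centred real Gaussian measure. -/
lemma map_add_gaussianReal {σ : ℝ} (hσ : 0 < σ) (c : ℝ) :
    (gaussianReal 0 (Real.toNNReal (σ ^ 2))).map (fun y => c + y) =
      (gaussianReal 0 (Real.toNNReal (σ ^ 2))).withDensity
        fun y => ENNReal.ofReal (Real.exp ((c * y - c ^ 2 / 2) / σ ^ 2)) := by
  have hv : Real.toNNReal (σ ^ 2) ≠ 0 := by
    simpa using hσ.ne'
  rw [gaussianReal_map_const_add, gaussianReal_of_var_ne_zero _ hv,
    gaussianReal_of_var_ne_zero _ hv, ← withDensity_mul _ (measurable_gaussianPDF _ _)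
      (by fun_prop)]
  congr 1
  ext y
  simp only [Pi.mul_apply, gaussianPDF]
  rw [← ENNReal.ofReal_mul (gaussianPDFReal_nonneg _ _ _)]
  congr 1
  rw [gaussianPDFReal, gaussianPDFReal, mul_assoc (√_)⁻¹, ← Real.exp_add,
    Real.coe_toNNReal _ (sq_nonneg σ)]
  congr 2
  field_simp
  ring

instance isProbabilityMeasure_whiteNoise (m : ℕ) (σ : ℝ) :
    IsProbabilityMeasure (whiteNoise m σ) := by
  unfold whiteNoise; infer_instance

/-- The log-likelihood ratio of Gaussian white noise translated by `w`. -/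
noncomputable def shiftLog {N m : ℕ} (σ : ℝ) (w y : Fin N → Fin m → ℝ) : ℝ :=
  ∑ i, ∑ l, (w i l * y i l - w i l ^ 2 / 2) / σ ^ 2

@[fun_prop]
lemma measurable_shiftLog {N m : ℕ} (σ : ℝ) (w : Fin N → Fin m → ℝ) :
    Measurable (shiftLog σ w) := by
  unfold shiftLog; fun_prop

/-- The noise in all the observations. -/
noncomputable def dataNoise (N m : ℕ) (σ : ℝ) : Measure (Fin N → Fin m → ℝ) :=
  Measure.pi fun _ => whiteNoise m σ

instance isProbabilityMeasure_dataNoise (N m : ℕ) (σ : ℝ) :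
    IsProbabilityMeasure (dataNoise N m σ) := by
  unfold dataNoise; infer_instance

lemma map_add_dataNoise {N m : ℕ} {σ : ℝ} (hσ : 0 < σ) (w : Fin N → Fin m → ℝ) :
    (dataNoise N m σ).map (fun y => w + y) =
      (dataNoise N m σ).withDensity fun y => ENNReal.ofReal (Real.exp (shiftLog σ w y)) := by
  have h := map_add_pi (fun _ : Fin N => whiteNoise m σ) w
    (fun i y => ∏ l, ENNReal.ofReal (Real.exp ((w i l * y l - w i l ^ 2 / 2) / σ ^ 2)))
    (fun i => Finset.measurable_prod _ fun l _ => by fun_prop) fun i =>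
      map_add_pi (fun _ : Fin m => gaussianReal 0 (Real.toNNReal (σ ^ 2))) (w i)
        (fun l y => ENNReal.ofReal (Real.exp ((w i l * y - w i l ^ 2 / 2) / σ ^ 2)))
        (fun l => by fun_prop) fun l => map_add_gaussianReal hσ (w i l)
  rw [dataNoise, h]
  congr 1
  ext y
  rw [shiftLog, Real.exp_sum, ENNReal.ofReal_prod_of_nonneg fun i _ => (Real.exp_pos _).le]
  refine Finset.prod_congr rfl fun i _ => ?_
  rw [Real.exp_sum, ENNReal.ofReal_prod_of_nonneg fun i _ => (Real.exp_pos _).le]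

lemma lintegral_add_dataNoise {N m : ℕ} {σ : ℝ} (hσ : 0 < σ) (w : Fin N → Fin m → ℝ)
    {g : (Fin N → Fin m → ℝ) → ℝ≥0∞} (hg : Measurable g) :
    ∫⁻ y, g (w + y) ∂(dataNoise N m σ) =
      ∫⁻ y, ENNReal.ofReal (Real.exp (shiftLog σ w y)) * g y ∂(dataNoise N m σ) := by
  rw [← lintegral_map hg (measurable_const_add w), map_add_dataNoise hσ,
    lintegral_withDensity_eq_lintegral_mul _ (by fun_prop) hg]
  rfl

lemma lintegral_exp_shiftLog {N m : ℕ} {σ : ℝ} (hσ : 0 < σ) (w : Fin N → Fin m → ℝ) :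
    ∫⁻ y, ENNReal.ofReal (Real.exp (shiftLog σ w y)) ∂(dataNoise N m σ) = 1 := by
  have := lintegral_add_dataNoise hσ w (g := fun _ => 1) measurable_const
  simpa using this.symm

/-- The terms linear in `y` cancel, so the product of the two likelihood ratios is deterministic.
This is why the noise is centred at the midpoint of the two hypotheses. -/
lemma shiftLog_add_shiftLog_neg {N m : ℕ} (σ : ℝ) (w y : Fin N → Fin m → ℝ) :
    shiftLog σ w y + shiftLog σ (-w) y = -((∑ i, ∑ l, w i l ^ 2) / σ ^ 2) := by
  simp only [shiftLog, ← Finset.sum_add_distrib, Finset.sum_div, ← Finset.sum_neg_distrib,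
    Pi.neg_apply]
  exact Finset.sum_congr rfl fun i _ => Finset.sum_congr rfl fun l _ => by ring

/-! ### Two-point lower bounds -/

/-- Minimising over `t` leaves `4 a² A B / (A + B)`; then `4 / S ≥ 4 - S`, the tangent at `S = 2`,
makes the bound linear in `A + B`. For likelihood ratios `A B` is constant and `A + B` has mean `2`,
the point of tangency. -/
lemma two_point_pointwise (t a : ℝ) {A B : ℝ} (hA : 0 < A) (hB : 0 < B) :
    4 * a ^ 2 * (A * B) ≤
      A * (t - a) ^ 2 + B * (t + a) ^ 2 + a ^ 2 * (A * B) * (A + B) := by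
  have hS : 0 < A + B := add_pos hA hB
  have h1 : 4 * a ^ 2 * (A * B) / (A + B) ≤ A * (t - a) ^ 2 + B * (t + a) ^ 2 := by
    rw [div_le_iff₀ hS]
    -- The square vanishes at the minimiser `t = a (A - B) / (A + B)`.
    nlinarith [sq_nonneg ((t - a) * A + (t + a) * B)]
  have h2 : 4 * a ^ 2 * (A * B) ≤
      4 * a ^ 2 * (A * B) / (A + B) + a ^ 2 * (A * B) * (A + B) := by
    have : 4 * a ^ 2 * (A * B) / (A + B) + a ^ 2 * (A * B) * (A + B) - 4 * a ^ 2 * (A * B) =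
        a ^ 2 * (A * B) * (A + B - 2) ^ 2 / (A + B) := by
      field_simp
      ring
    have h3 : 0 ≤ a ^ 2 * (A * B) * (A + B - 2) ^ 2 / (A + B) := by positivity
    linarith
  linarith

/-- Estimating the sign of a shift by `±w` of Gaussian white noise. -/
lemma two_point_dataNoise {N m : ℕ} {σ : ℝ} (hσ : 0 < σ) (w : Fin N → Fin m → ℝ) (a : ℝ)
    {T : (Fin N → Fin m → ℝ) → ℝ} (hT : Measurable T) :
    ENNReal.ofReal (2 * a ^ 2 * Real.exp (-((∑ i, ∑ l, w i l ^ 2) / σ ^ 2))) ≤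
      ∫⁻ y, ENNReal.ofReal ((T (w + y) - a) ^ 2) ∂(dataNoise N m σ) +
        ∫⁻ y, ENNReal.ofReal ((T (-w + y) + a) ^ 2) ∂(dataNoise N m σ) := by
  set e := Real.exp (-((∑ i, ∑ l, w i l ^ 2) / σ ^ 2)) with he
  rw [lintegral_add_dataNoise hσ w (g := fun y => ENNReal.ofReal ((T y - a) ^ 2)) (by fun_prop),
    lintegral_add_dataNoise hσ (-w) (g := fun y => ENNReal.ofReal ((T y + a) ^ 2)) (by fun_prop)]
  set L : (Fin N → Fin m → ℝ) → (Fin N → Fin m → ℝ) → ℝ≥0∞ :=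
    fun w y => ENNReal.ofReal (Real.exp (shiftLog σ w y)) with hL
  have hLm : ∀ w, Measurable (L w) := fun w => by simp only [hL]; fun_prop
  have hc : 0 ≤ a ^ 2 * e := by positivity
  have hpt : ∀ y, ENNReal.ofReal (4 * a ^ 2 * e) ≤
      (L w y * ENNReal.ofReal ((T y - a) ^ 2) + L (-w) y * ENNReal.ofReal ((T y + a) ^ 2)) +
        ENNReal.ofReal (a ^ 2 * e) * (L w y + L (-w) y) := by
    intro y
    have h := two_point_pointwise (T y) a (Real.exp_pos (shiftLog σ w y))
      (Real.exp_pos (shiftLog σ (-w) y))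
    rw [← Real.exp_add, shiftLog_add_shiftLog_neg, ← he] at h
    simp only [hL]
    rw [← ENNReal.ofReal_mul (by positivity), ← ENNReal.ofReal_mul (by positivity),
      ← ENNReal.ofReal_add (by positivity) (by positivity),
      ← ENNReal.ofReal_add (by positivity) (by positivity), ← ENNReal.ofReal_mul hc,
      ← ENNReal.ofReal_add (by positivity) (by positivity)]
    exact ENNReal.ofReal_le_ofReal h
  have hint := lintegral_mono (μ := dataNoise N m σ) hpt
  rw [lintegral_const, measure_univ, mul_one, lintegral_add_right _ (by fun_prop),
    lintegral_add_right _ (by fun_prop), lintegral_const_mul _ (by fun_prop),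
    lintegral_add_right _ (hLm _), lintegral_exp_shiftLog hσ, lintegral_exp_shiftLog hσ] at hint
  -- Each likelihood ratio integrates to `1`, so the correction takes `2 a² e` out of `4 a² e`.
  have hsplit : ENNReal.ofReal (4 * a ^ 2 * e) =
      ENNReal.ofReal (2 * a ^ 2 * e) + ENNReal.ofReal (a ^ 2 * e) * (1 + 1) := by
    rw [one_add_one_eq_two, ← ENNReal.ofReal_ofNat 2, ← ENNReal.ofReal_mul hc,
      ← ENNReal.ofReal_add (by positivity) (by positivity)]
    congr 1
    ring
  rw [hsplit] at hint
  exact (ENNReal.add_le_add_iff_right (by finiteness)).1 hint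

instance isProbabilityMeasure_obsLaw {m p : ℕ} (P : Measure (Fin p → ℝ)) [IsProbabilityMeasure P]
    (σ : ℝ) (D : Matrix (Fin m) (Fin p) ℝ) : IsProbabilityMeasure (obsLaw P σ D) :=
  Measure.isProbabilityMeasure_map (by unfold Matrix.mulVec dotProduct; fun_prop)

/-- The law of the data as a mixture, over the coefficients, of translates of the noise. -/
lemma lintegral_dataLaw {m p N : ℕ} (P : Measure (Fin p → ℝ)) [IsProbabilityMeasure P] (σ : ℝ)
    (D : Matrix (Fin m) (Fin p) ℝ) {g : (Fin N → Fin m → ℝ) → ℝ≥0∞} (hg : Measurable g) :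
    ∫⁻ Y, g Y ∂(dataLaw N P σ D) =
      ∫⁻ X, ∫⁻ y, g ((fun i => D *ᵥ X i) + y) ∂(dataNoise N m σ)
        ∂(Measure.pi fun _ : Fin N => P) := by
  have hm : Measurable fun xn : (Fin p → ℝ) × (Fin m → ℝ) => D *ᵥ xn.1 + xn.2 := by
    unfold Matrix.mulVec dotProduct; fun_prop
  have hM : Measurable fun XY : (Fin N → Fin p → ℝ) × (Fin N → Fin m → ℝ) =>
      g ((fun i => D *ᵥ XY.1 i) + XY.2) := by
    refine hg.comp ?_
    unfold Matrix.mulVec dotProduct; fun_prop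
  have hprob : IsProbabilityMeasure ((P.prod (whiteNoise m σ)).map
    fun xn => D *ᵥ xn.1 + xn.2) := isProbabilityMeasure_obsLaw P σ D
  unfold dataLaw obsLaw
  rw [← Measure.pi_map_pi (fun _ => hm.aemeasurable), lintegral_map hg (by fun_prop)]
  have hpres := measurePreserving_arrowProdEquivProdArrow (Fin p → ℝ) (Fin m → ℝ) (Fin N)
    (fun _ => P) (fun _ => whiteNoise m σ)
  have h := hpres.lintegral_comp hM
  rw [dataNoise, ← lintegral_prod _ hM.aemeasurable]
  exact h

lemma apply_self_le_specNorm {p : ℕ} (A : Matrix (Fin p) (Fin p) ℝ) (k : Fin p) :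
    A k k ≤ specNorm A := by
  have h := Matrix.inner_toEuclideanCLM A (EuclideanSpace.single k (1 : ℝ))
    (EuclideanSpace.single k (1 : ℝ))
  have h1 : A k k = inner ℝ (EuclideanSpace.single k (1 : ℝ))
      (Matrix.toEuclideanCLM (n := Fin p) (𝕜 := ℝ) A (EuclideanSpace.single k (1 : ℝ))) := by
    rw [h]; simp
  rw [h1]
  calc _ ≤ ‖EuclideanSpace.single k (1 : ℝ)‖ * ‖Matrix.toEuclideanCLM (n := Fin p) (𝕜 := ℝ) A
        (EuclideanSpace.single k (1 : ℝ))‖ := real_inner_le_norm _ _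
    _ ≤ 1 * (specNorm A * 1) := by
        have := (Matrix.toEuclideanCLM (n := Fin p) (𝕜 := ℝ) A).le_opNorm
          (EuclideanSpace.single k (1 : ℝ))
        simpa [specNorm] using this
    _ = specNorm A := by ring

/-- The expected energy of one coefficient in all the observations. -/
lemma lintegral_sum_sq_coeff {p : ℕ} (N : ℕ) (P : Measure (Fin p → ℝ)) [IsProbabilityMeasure P]
    (hP2 : ∀ i, MemLp (fun x : Fin p → ℝ => x i) 2 P) (k : Fin p) {c : ℝ} (hc : 0 ≤ c) :
    ∫⁻ X, ENNReal.ofReal (c * ∑ i, X i k ^ 2) ∂(Measure.pi fun _ : Fin N => P) =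
      ENNReal.ofReal (c * (N * covMat P k k)) := by
  have hint : Integrable (fun x : Fin p → ℝ => x k ^ 2) P := (hP2 k).integrable_sq
  have hint' : ∀ i : Fin N, Integrable (fun X : Fin N → Fin p → ℝ => X i k ^ 2)
      (Measure.pi fun _ => P) := fun i =>
    integrable_comp_eval (μ := fun _ => P) (i := i) (f := fun x : Fin p → ℝ => x k ^ 2) hint
  rw [← ofReal_integral_eq_lintegral_ofReal
    ((integrable_finsetSum _ fun i _ => hint' i).const_mul c)
    (Filter.Eventually.of_forall fun X => by positivity),
    integral_const_mul, integral_finsetSum _ fun i _ => hint' i]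
  congr 2
  have : ∀ i : Fin N, ∫ X : Fin N → Fin p → ℝ, X i k ^ 2 ∂(Measure.pi fun _ => P) =
      covMat P k k := fun i => by
    refine (integral_comp_eval (μ := fun _ => P) (i := i) (f := fun x : Fin p → ℝ => x k ^ 2)
      hint.aestronglyMeasurable).trans ?_
    simp [covMat, sq]
  simp [this]

/-- Two dictionaries that differ by `2 a u` in one column, with `u` a unit vector, cannot be told
apart if `a` is small. -/
lemma two_point_dataLaw {m p N : ℕ} (P : Measure (Fin p → ℝ)) [IsProbabilityMeasure P]
    (hP2 : ∀ i, MemLp (fun x : Fin p → ℝ => x i) 2 P) {σ : ℝ} (hσ : 0 < σ)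
    (M : Matrix (Fin m) (Fin p) ℝ) (k : Fin p) {u : Fin m → ℝ} (hu : ∑ l, u l ^ 2 = 1) {a : ℝ}
    (ha : 2 * a ^ 2 * (N * specNorm (covMat P)) ≤ σ ^ 2)
    {T : (Fin N → Fin m → ℝ) → ℝ} (hT : Measurable T) :
    ENNReal.ofReal (a ^ 2) ≤
      ∫⁻ Y, ENNReal.ofReal ((T Y - a) ^ 2)
          ∂(dataLaw N P σ (M + a • Matrix.vecMulVec u (Pi.single k 1))) +
        ∫⁻ Y, ENNReal.ofReal ((T Y + a) ^ 2)
          ∂(dataLaw N P σ (M - a • Matrix.vecMulVec u (Pi.single k 1))) := by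
  rw [lintegral_dataLaw P σ _ (g := fun Y => ENNReal.ofReal ((T Y - a) ^ 2)) (by fun_prop),
    lintegral_dataLaw P σ _ (g := fun Y => ENNReal.ofReal ((T Y + a) ^ 2)) (by fun_prop)]
  set Q : Measure (Fin N → Fin p → ℝ) := Measure.pi fun _ : Fin N => P
  have hmeas : ∀ (D : Matrix (Fin m) (Fin p) ℝ) (b : ℝ), Measurable fun X : Fin N → Fin p → ℝ =>
      ∫⁻ y, ENNReal.ofReal ((T ((fun i => D *ᵥ X i) + y) + b) ^ 2) ∂(dataNoise N m σ) := by
    intro D b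
    refine Measurable.lintegral_prod_right'
      (f := fun XY : (Fin N → Fin p → ℝ) × (Fin N → Fin m → ℝ) =>
        ENNReal.ofReal ((T ((fun i => D *ᵥ XY.1 i) + XY.2) + b) ^ 2)) ?_
    have : Measurable fun XY : (Fin N → Fin p → ℝ) × (Fin N → Fin m → ℝ) =>
        (fun i => D *ᵥ XY.1 i) + XY.2 := by
      unfold Matrix.mulVec dotProduct; fun_prop
    fun_prop
  -- The bound holds for each fixed `X`, as if the coefficients were revealed to the estimator.
  have hpt : ∀ X : Fin N → Fin p → ℝ, ENNReal.ofReal (2 * a ^ 2) ≤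
      (∫⁻ y, ENNReal.ofReal ((T ((fun i =>
          (M + a • Matrix.vecMulVec u (Pi.single k 1)) *ᵥ X i) + y) - a) ^ 2) ∂(dataNoise N m σ) +
        ∫⁻ y, ENNReal.ofReal ((T ((fun i =>
          (M - a • Matrix.vecMulVec u (Pi.single k 1)) *ᵥ X i) + y) + a) ^ 2)
            ∂(dataNoise N m σ)) +
        ENNReal.ofReal (2 * a ^ 2 * (a ^ 2 / σ ^ 2) * ∑ i, X i k ^ 2) := by
    intro X
    have hmul : ∀ x : Fin p → ℝ, Matrix.vecMulVec u (Pi.single k 1) *ᵥ x = x k • u := by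
      intro x
      rw [Matrix.vecMulVec_mulVec]
      ext l
      simp [mul_comm]
    set w : Fin N → Fin m → ℝ := fun i => (a * X i k) • u with hw
    -- The common part `M X` is absorbed into the statistic, leaving a pure shift by `±w`.
    have h := two_point_dataNoise hσ w a (T := fun y => T ((fun i => M *ᵥ X i) + y))
      (by fun_prop)
    have hp : ∀ y, (fun i => (M + a • Matrix.vecMulVec u (Pi.single k 1)) *ᵥ X i) + y =
        (fun i => M *ᵥ X i) + (w + y) := by
      intro y
      rw [← add_assoc]
      congr 1
      ext i l
      simp [Matrix.add_mulVec, Matrix.smul_mulVec, hmul, hw, mul_assoc]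
    have hn : ∀ y, (fun i => (M - a • Matrix.vecMulVec u (Pi.single k 1)) *ᵥ X i) + y =
        (fun i => M *ᵥ X i) + (-w + y) := by
      intro y
      rw [← add_assoc]
      congr 1
      ext i l
      simp [Matrix.sub_mulVec, Matrix.smul_mulVec, hmul, hw, mul_assoc, ← sub_eq_add_neg]
    simp only [hp, hn]
    refine le_trans ?_ (add_le_add_left h _)
    rw [← ENNReal.ofReal_add (by positivity) (by positivity)]
    refine ENNReal.ofReal_le_ofReal ?_
    have hsum : ∑ i, ∑ l, w i l ^ 2 = a ^ 2 * ∑ i, X i k ^ 2 := by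
      simp only [hw, Pi.smul_apply, smul_eq_mul, mul_pow, ← Finset.mul_sum, hu, mul_one]
    rw [hsum]
    -- `exp (-x) ≥ 1 - x` makes the loss linear in the energy of the coefficients, so its mean is
    -- given by the covariance.
    have := mul_le_mul_of_nonneg_left (Real.add_one_le_exp (-(a ^ 2 * (∑ i, X i k ^ 2) / σ ^ 2)))
      (by positivity : 0 ≤ 2 * a ^ 2)
    calc 2 * a ^ 2 = 2 * a ^ 2 * (-(a ^ 2 * (∑ i, X i k ^ 2) / σ ^ 2) + 1) +
          2 * a ^ 2 * (a ^ 2 / σ ^ 2) * ∑ i, X i k ^ 2 := by ring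
      _ ≤ _ := by gcongr
  have hint := lintegral_mono (μ := Q) hpt
  rw [lintegral_const, measure_univ, mul_one, lintegral_add_right _ (by fun_prop),
    lintegral_add_right _ (hmeas _ _),
    lintegral_sum_sq_coeff N P hP2 k (by positivity)] at hint
  -- The assumption on `a` is exactly what keeps the mean loss to half of `2 a²`.
  have hle : 2 * a ^ 2 * (a ^ 2 / σ ^ 2) * (N * covMat P k k) ≤ a ^ 2 := by
    have h1 : (N : ℝ) * covMat P k k ≤ N * specNorm (covMat P) :=
      mul_le_mul_of_nonneg_left (apply_self_le_specNorm _ _) (Nat.cast_nonneg N)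
    calc _ ≤ 2 * a ^ 2 * (a ^ 2 / σ ^ 2) * (N * specNorm (covMat P)) := by gcongr
      _ = a ^ 2 / σ ^ 2 * (2 * a ^ 2 * (N * specNorm (covMat P))) := by ring
      _ ≤ a ^ 2 / σ ^ 2 * σ ^ 2 := by gcongr
      _ = a ^ 2 := by field_simp
  have hfin := hint.trans (add_le_add_right (ENNReal.ofReal_le_ofReal hle) _)
  rw [two_mul, ENNReal.ofReal_add (by positivity) (by positivity)] at hfin
  exact (ENNReal.add_le_add_iff_right (by finiteness)).1 hfin

/-! ### A hypercube of dictionaries -/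

lemma frobNorm_sq {m p : ℕ} (A : Matrix (Fin m) (Fin p) ℝ) :
    frobNorm A ^ 2 = ∑ k, A.col k ⬝ᵥ A.col k := by
  have h : (A * Aᵀ).trace = ∑ k, A.col k ⬝ᵥ A.col k := by
    simp only [Matrix.trace, Matrix.diag, Matrix.mul_apply, Matrix.transpose_apply, dotProduct,
      Matrix.col_apply]
    exact Finset.sum_comm
  rw [frobNorm, h, Real.sq_sqrt]
  exact Finset.sum_nonneg fun k _ => Finset.sum_nonneg fun l _ => mul_self_nonneg _

/-- Every unit vector is the first vector of an orthonormal basis. -/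
lemma exists_orthonormal_extension {n : ℕ} {d : Fin (n + 1) → ℝ} (hd : d ⬝ᵥ d = 1) :
    ∃ u : Fin (n + 1) → Fin (n + 1) → ℝ, u 0 = d ∧
      (∀ i j, u i ⬝ᵥ u j = if i = j then 1 else 0) ∧
      ∀ x, ∑ i, (u i ⬝ᵥ x) ^ 2 = x ⬝ᵥ x := by
  have hinner : ∀ x y : EuclideanSpace ℝ (Fin (n + 1)), inner ℝ x y = x.ofLp ⬝ᵥ y.ofLp := by
    intro x y
    simp [PiLp.inner_apply, dotProduct, mul_comm]
  have hv : Orthonormal ℝ (({0} : Set (Fin (n + 1))).domRestrict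
      fun _ => (WithLp.toLp 2 d : EuclideanSpace ℝ (Fin (n + 1)))) := by
    refine ⟨fun i => ?_, fun i j hij => absurd (Subsingleton.elim i j) hij⟩
    have : ‖(WithLp.toLp 2 d : EuclideanSpace ℝ (Fin (n + 1)))‖ ^ 2 = 1 := by
      rw [← real_inner_self_eq_norm_sq, hinner, hd]
    exact (pow_eq_one_iff_of_nonneg (norm_nonneg _) two_ne_zero).1 this
  obtain ⟨b, hb⟩ := hv.exists_orthonormalBasis_extension_of_card_eq (by simp)
  refine ⟨fun i => (b i).ofLp, by simp [hb 0 rfl], fun i j => ?_, fun x => ?_⟩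
  · rw [← hinner]
    exact orthonormal_iff_ite.1 b.orthonormal i j
  · have h := b.sum_sq_norm_inner_right (WithLp.toLp 2 x)
    rw [← real_inner_self_eq_norm_sq, hinner] at h
    simpa only [hinner, Real.norm_eq_abs, sq_abs] using h

/-- The matrix whose `k`-th column is `c u_{k,0} + a ∑ⱼ s_{k,j} u_{k,j+1}`. -/
noncomputable def cubeMatrix {n p : ℕ} (u : Fin p → Fin (n + 1) → Fin (n + 1) → ℝ) (c a : ℝ)
    (s : Fin p × Fin n → ℝ) : Matrix (Fin (n + 1)) (Fin p) ℝ :=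
  Matrix.of fun l k => c * u k 0 l + a * ∑ j, s (k, j) * u k j.succ l

section

variable {n p : ℕ} {u : Fin p → Fin (n + 1) → Fin (n + 1) → ℝ}

lemma col_cubeMatrix (c a : ℝ) (s : Fin p × Fin n → ℝ) (k : Fin p) :
    (cubeMatrix u c a s).col k = c • u k 0 + a • ∑ j, s (k, j) • u k j.succ := by
  ext l
  simp [cubeMatrix, Matrix.col_apply, Finset.sum_apply]

lemma dotProduct_col_cubeMatrix_zero
    (hu : ∀ k i j, u k i ⬝ᵥ u k j = if i = j then 1 else 0) (c a : ℝ) (s : Fin p × Fin n → ℝ)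
    (k : Fin p) : u k 0 ⬝ᵥ (cubeMatrix u c a s).col k = c := by
  simp [col_cubeMatrix, dotProduct_add, dotProduct_smul, dotProduct_sum, hu,
    (Fin.succ_ne_zero _).symm]

lemma dotProduct_col_cubeMatrix_succ
    (hu : ∀ k i j, u k i ⬝ᵥ u k j = if i = j then 1 else 0) (c a : ℝ) (s : Fin p × Fin n → ℝ)
    (k : Fin p) (j : Fin n) : u k j.succ ⬝ᵥ (cubeMatrix u c a s).col k = a * s (k, j) := by
  simp [col_cubeMatrix, dotProduct_add, dotProduct_smul, dotProduct_sum, hu]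

lemma cubeMatrix_mem_dictionaries
    (hu : ∀ k i j, u k i ⬝ᵥ u k j = if i = j then 1 else 0)
    (hpars : ∀ k x, ∑ i, (u k i ⬝ᵥ x) ^ 2 = x ⬝ᵥ x) {c a : ℝ} (hca : c ^ 2 + n * a ^ 2 = 1)
    {s : Fin p × Fin n → ℝ} (hs : ∀ i, s i ^ 2 = 1) :
    cubeMatrix u c a s ∈ dictionaries (n + 1) p := by
  intro k
  have h := hpars k ((cubeMatrix u c a s).col k)
  simp only [Fin.sum_univ_succ, dotProduct_col_cubeMatrix_zero hu,
    dotProduct_col_cubeMatrix_succ hu, mul_pow, hs, mul_one, Finset.sum_const, Finset.card_univ,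
    Fintype.card_fin, nsmul_eq_mul, hca] at h
  exact h.symm

lemma frobNorm_cubeMatrix_sub_sq
    (hu : ∀ k i j, u k i ⬝ᵥ u k j = if i = j then 1 else 0)
    (hpars : ∀ k x, ∑ i, (u k i ⬝ᵥ x) ^ 2 = x ⬝ᵥ x) {c a : ℝ}
    {s : Fin p × Fin n → ℝ} (hs : ∀ i, s i ^ 2 = 1) {D₀ : Matrix (Fin (n + 1)) (Fin p) ℝ}
    (hD₀ : ∀ k, u k 0 = D₀.col k) :
    frobNorm (cubeMatrix u c a s - D₀) ^ 2 = p * ((c - 1) ^ 2 + n * a ^ 2) := by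
  have hcol : ∀ k, (cubeMatrix u c a s - D₀).col k = (cubeMatrix u c a s).col k - u k 0 := by
    intro k; rw [hD₀]; rfl
  rw [frobNorm_sq]
  rw [Finset.sum_congr rfl fun k _ => (hpars k _).symm]
  simp only [hcol, dotProduct_sub, Fin.sum_univ_succ, dotProduct_col_cubeMatrix_zero hu,
    dotProduct_col_cubeMatrix_succ hu, hu, Fin.succ_ne_zero, if_true, if_false, sub_zero, mul_pow,
    hs, mul_one, Finset.sum_const, Finset.card_univ, Fintype.card_fin, nsmul_eq_mul]

/-- Parseval in each column's basis, with the component along `u k 0` discarded. The estimate `D`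
need not have unit columns. -/
lemma sum_sq_le_frobNorm_sub_cubeMatrix_sq
    (hu : ∀ k i j, u k i ⬝ᵥ u k j = if i = j then 1 else 0)
    (hpars : ∀ k x, ∑ i, (u k i ⬝ᵥ x) ^ 2 = x ⬝ᵥ x) (c a : ℝ)
    (s : Fin p × Fin n → ℝ) (D : Matrix (Fin (n + 1)) (Fin p) ℝ) :
    ∑ i : Fin p × Fin n, (u i.1 i.2.succ ⬝ᵥ D.col i.1 - a * s i) ^ 2 ≤
      frobNorm (D - cubeMatrix u c a s) ^ 2 := by
  have hcol : ∀ k, (D - cubeMatrix u c a s).col k = D.col k - (cubeMatrix u c a s).col k :=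
    fun k => rfl
  rw [frobNorm_sq, Fintype.sum_prod_type]
  refine Finset.sum_le_sum fun k _ => ?_
  rw [← hpars k, Fin.sum_univ_succ]
  simp only [hcol, dotProduct_sub, dotProduct_col_cubeMatrix_succ hu]
  exact le_add_of_nonneg_left (sq_nonneg _)

/-- Putting `0` in coordinate `i` gives the midpoint of two neighbouring vertices. It need not be a
dictionary; it only serves as the centre `M` in `two_point_dataLaw`. -/
lemma cubeMatrix_update (c a : ℝ) (s : Fin p × Fin n → ℝ) (i : Fin p × Fin n) (t : ℝ) :
    cubeMatrix u c a (Function.update s i t) = cubeMatrix u c a (Function.update s i 0) +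
      (a * t) • Matrix.vecMulVec (u i.1 i.2.succ) (Pi.single i.1 1) := by
  obtain ⟨k, j⟩ := i
  ext l k'
  simp only [cubeMatrix, Matrix.of_apply, Matrix.add_apply, Matrix.smul_apply,
    Matrix.vecMulVec_apply, smul_eq_mul]
  have h : ∀ j', Function.update s (k, j) t (k', j') * u k' j'.succ l =
      Function.update s (k, j) 0 (k', j') * u k' j'.succ l +
        if j' = j then t * (u k j.succ l * Pi.single (M := fun _ => ℝ) k 1 k') else 0 := by
    intro j'
    by_cases hk : k' = k
    · subst hk
      by_cases hj : j' = j
      · subst hj; simp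
      · simp [hj]
    · simp [hk]
  simp only [h, Finset.sum_add_distrib, Finset.sum_ite_eq', Finset.mem_univ, if_true]
  ring

end

/-! ### Averaging over the hypercube -/

/-- If flipping the `i`-th bit always costs `b` in the `i`-th summand, then the average over the
hypercube of the sum of the summands is at least `b / 2` times the dimension. -/
lemma card_mul_le_two_mul_sum_cube {κ : Type*} [Fintype κ] [DecidableEq κ]
    (g : κ → (κ → Bool) → ℝ≥0∞) (b : ℝ≥0∞)
    (h : ∀ i θ, b ≤ g i θ + g i (Function.update θ i (!θ i))) :
    Fintype.card (κ → Bool) * (Fintype.card κ * b) ≤ 2 * ∑ θ, ∑ i, g i θ := by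
  have hi : ∀ i, Fintype.card (κ → Bool) * b ≤ 2 * ∑ θ, g i θ := by
    intro i
    -- Flipping permutes the cube, so both terms of `h` have the same sum over `θ`.
    have hinv : Function.Involutive fun θ : κ → Bool => Function.update θ i (!θ i) := by
      intro θ; simp
    have hflip : ∑ θ, g i (Function.update θ i (!θ i)) = ∑ θ, g i θ :=
      Equiv.sum_comp hinv.toPerm (g i)
    calc Fintype.card (κ → Bool) * b = ∑ _θ : κ → Bool, b := by simp
      _ ≤ ∑ θ, (g i θ + g i (Function.update θ i (!θ i))) := Finset.sum_le_sum fun θ _ => h i θ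
      _ = 2 * ∑ θ, g i θ := by rw [Finset.sum_add_distrib, hflip, two_mul]
  calc Fintype.card (κ → Bool) * (Fintype.card κ * b) =
        ∑ _i : κ, Fintype.card (κ → Bool) * b := by
          rw [Finset.sum_const, Finset.card_univ, nsmul_eq_mul]; ring
    _ ≤ ∑ i, 2 * ∑ θ, g i θ := Finset.sum_le_sum fun i _ => hi i
    _ = 2 * ∑ θ, ∑ i, g i θ := by rw [← Finset.mul_sum, Finset.sum_comm]

/-- The sign of a bit. -/
def bitSign (b : Bool) : ℝ := if b then 1 else -1

lemma bitSign_sq (b : Bool) : bitSign b ^ 2 = 1 := by cases b <;> simp [bitSign]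

lemma bitSign_not (b : Bool) : bitSign (!b) = -bitSign b := by cases b <;> simp [bitSign]

/-- The lower bound for the minimax risk that a hypercube of dictionaries with half side `a`
gives. -/
lemma ofReal_le_minimaxRisk {n p : ℕ} (N : ℕ) (P : Measure (Fin p → ℝ)) [IsProbabilityMeasure P]
    (hP2 : ∀ i, MemLp (fun x : Fin p → ℝ => x i) 2 P) {σ : ℝ} (hσ : 0 < σ)
    {D₀ : Matrix (Fin (n + 1)) (Fin p) ℝ} (hD₀ : D₀ ∈ dictionaries (n + 1) p)
    {r : ℝ} (hr : 0 < r) (hrp : r ≤ 2 * √(p : ℝ)) (hp : 0 < p) {a : ℝ}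
    (har : 4 * (p * n * a ^ 2) ≤ r ^ 2)
    (haσ : 2 * a ^ 2 * (N * specNorm (covMat P)) ≤ σ ^ 2) :
    ENNReal.ofReal (p * n * a ^ 2 / 2) ≤ minimaxRisk N P σ D₀ r := by
  choose u hu0 hu hpars using fun k => exists_orthonormal_extension (d := D₀.col k) (hD₀ k)
  have hp' : (0 : ℝ) < p := Nat.cast_pos.2 hp
  -- The bound `r ≤ 2√p` leaves room for the perturbation inside a unit column.
  have hna : n * a ^ 2 ≤ 1 := by
    have h1 : r ^ 2 ≤ 4 * p := by
      calc r ^ 2 ≤ (2 * √(p : ℝ)) ^ 2 := by gcongr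
        _ = 4 * (p : ℝ) := by rw [mul_pow, Real.sq_sqrt hp'.le]; norm_num
    have h2 : (p : ℝ) * (n * a ^ 2) ≤ p * 1 := by linarith
    exact le_of_mul_le_mul_left h2 hp'
  set c := √(1 - n * a ^ 2) with hc
  have hc0 : 0 ≤ c := Real.sqrt_nonneg _
  have hca : c ^ 2 + n * a ^ 2 = 1 := by
    rw [hc, Real.sq_sqrt (by linarith)]; ring
  have hc1 : c ≤ 1 := by
    have : 0 ≤ n * a ^ 2 := by positivity
    nlinarith
  set D : (Fin p × Fin n → Bool) → Matrix (Fin (n + 1)) (Fin p) ℝ :=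
    fun θ => cubeMatrix u c a fun i => bitSign (θ i) with hD
  have hmem : ∀ θ, D θ ∈ localDictionaries D₀ r := by
    intro θ
    refine ⟨cubeMatrix_mem_dictionaries hu hpars hca fun i => bitSign_sq _,
      lt_of_pow_lt_pow_left₀ 2 hr.le ?_⟩
    rw [frobNorm_cubeMatrix_sub_sq hu hpars (fun i => bitSign_sq _) hu0]
    -- The left side is `2 (1 - c)`, and `1 - c ≤ 1 - c² = n a²` for `0 ≤ c ≤ 1`. With `har` the
    -- squared distance is at most `r² / 2`, hence strictly inside the ball.
    have h1 : (c - 1) ^ 2 + n * a ^ 2 ≤ 2 * (n * a ^ 2) := by nlinarith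
    have h2 := mul_le_mul_of_nonneg_left h1 hp'.le
    have h3 : 0 < r ^ 2 := by positivity
    linarith
  refine le_iInf₂ fun Dhat hDhat => ?_
  set S := ⨆ D ∈ localDictionaries D₀ r, mse N P σ Dhat D
  set T : Fin p × Fin n → (Fin N → Fin (n + 1) → ℝ) → ℝ :=
    fun i Y => u i.1 i.2.succ ⬝ᵥ (Dhat Y).col i.1 with hT
  have hTm : ∀ i, Measurable (T i) := fun i => by
    simp only [hT, dotProduct, Matrix.col_apply]
    exact Finset.measurable_sum _ fun l _ => (hDhat l i.1).const_mul _
  set g : Fin p × Fin n → (Fin p × Fin n → Bool) → ℝ≥0∞ := fun i θ =>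
    ∫⁻ Y, ENNReal.ofReal ((T i Y - a * bitSign (θ i)) ^ 2) ∂(dataLaw N P σ (D θ)) with hg
  have hmse : ∀ θ, ∑ i, g i θ ≤ S := by
    intro θ
    refine le_trans ?_ (le_iSup₂_of_le (D θ) (hmem θ) le_rfl)
    rw [hg, ← lintegral_finsetSum _ fun i _ => by fun_prop]
    refine lintegral_mono fun Y => ?_
    rw [← ENNReal.ofReal_sum_of_nonneg fun i _ => sq_nonneg _]
    exact ENNReal.ofReal_le_ofReal (sum_sq_le_frobNorm_sub_cubeMatrix_sq hu hpars c a _ _)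
  have hflip : ∀ i θ, ENNReal.ofReal (a ^ 2) ≤ g i θ + g i (Function.update θ i (!θ i)) := by
    intro i θ
    have hunit : ∑ l, u i.1 i.2.succ l ^ 2 = 1 := by
      simpa [dotProduct, sq] using hu i.1 i.2.succ i.2.succ
    have hsq : (a * bitSign (θ i)) ^ 2 = a ^ 2 := by rw [mul_pow, bitSign_sq, mul_one]
    -- The signed amplitude makes the plus side `D θ` itself and the minus side its neighbour,
    -- whichever value the bit has.
    have h := two_point_dataLaw P hP2 hσ
      (cubeMatrix u c a (Function.update (fun i => bitSign (θ i)) i 0)) i.1 hunit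
      (a := a * bitSign (θ i)) (by rwa [hsq]) (hTm i)
    rw [hsq] at h
    have hplus : D θ = cubeMatrix u c a (Function.update (fun i => bitSign (θ i)) i 0) +
        (a * bitSign (θ i)) • Matrix.vecMulVec (u i.1 i.2.succ) (Pi.single i.1 1) := by
      rw [← cubeMatrix_update, Function.update_eq_self (f := fun i => bitSign (θ i))]
    have hminus : D (Function.update θ i (!θ i)) =
        cubeMatrix u c a (Function.update (fun i => bitSign (θ i)) i 0) -
          (a * bitSign (θ i)) • Matrix.vecMulVec (u i.1 i.2.succ) (Pi.single i.1 1) := by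
      rw [sub_eq_add_neg, ← neg_smul, ← mul_neg, ← cubeMatrix_update, ← bitSign_not]
      simp only [hD]
      congr 1
      ext i'
      by_cases hi : i' = i
      · subst hi; simp
      · simp [Function.update_of_ne hi]
    simp only [hg, hplus, hminus, Function.update_self, bitSign_not, mul_neg, sub_neg_eq_add]
    exact h
  have hcube := card_mul_le_two_mul_sum_cube g _ hflip
  have hS : 2 * ∑ θ, ∑ i, g i θ ≤ Fintype.card (Fin p × Fin n → Bool) * (2 * S) := by
    calc 2 * ∑ θ, ∑ i, g i θ ≤ 2 * ∑ _θ : Fin p × Fin n → Bool, S := by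
          gcongr with θ; exact hmse θ
      _ = _ := by rw [Finset.sum_const, Finset.card_univ, nsmul_eq_mul]; ring
  have hcancel := (ENNReal.mul_le_mul_iff_right
    (by simp) (ENNReal.natCast_ne_top _)).1 (hcube.trans hS)
  have hval : (Fintype.card (Fin p × Fin n) : ℝ≥0∞) * ENNReal.ofReal (a ^ 2) =
      2 * ENNReal.ofReal (p * n * a ^ 2 / 2) := by
    rw [← ENNReal.ofReal_natCast, ← ENNReal.ofReal_mul (Nat.cast_nonneg _),
      ← ENNReal.ofReal_ofNat 2, ← ENNReal.ofReal_mul (by norm_num)]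
    congr 1
    simp
    ring
  rw [hval] at hcancel
  exact (ENNReal.mul_le_mul_iff_right (by norm_num) (by norm_num)).1 hcancel

end DictLearn

/-! ### Choosing the side of the cube -/

theorem theorem1 {m p : ℕ} (N : ℕ)
    (P : MeasureTheory.Measure (Fin p → ℝ)) [MeasureTheory.IsProbabilityMeasure P]
    (hP2 : ∀ i, MeasureTheory.MemLp (fun x : Fin p → ℝ => x i) 2 P)
    (hP0 : ∀ i, ∫ x, x i ∂P = 0)
    (σ : ℝ) (hσ : 0 < σ)
    (D₀ : Matrix (Fin m) (Fin p) ℝ) (hD₀ : D₀ ∈ DictLearn.dictionaries m p)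
    (r : ℝ) (hr : 0 < r) (hrp : r ≤ 2 * √(p : ℝ))
    (hmp : 50 ≤ (p : ℝ) * ((m : ℝ) - 1)) :
    -- Division is in `[0, ∞]`: the second term is `∞` (so that the bound is `r² / 320`)
    -- if there are no observations or if the coefficient vector vanishes almost surely.
    ENNReal.ofReal (1 / 320) *
        min (ENNReal.ofReal (r ^ 2))
          (ENNReal.ofReal (σ ^ 2) /
              ENNReal.ofReal ((N : ℝ) * DictLearn.specNorm (DictLearn.covMat P)) *
            ENNReal.ofReal ((p : ℝ) * ((m : ℝ) - 1) / 10 - 1))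
      ≤ DictLearn.minimaxRisk N P σ D₀ r := by
  have hp : 0 < p := by
    rcases Nat.eq_zero_or_pos p with rfl | h
    · norm_num at hmp
    · exact h
  obtain _ | n := m
  · have : (0 : ℝ) ≤ p := Nat.cast_nonneg p
    push_cast at hmp
    linarith
  push_cast at hmp ⊢
  rw [add_sub_cancel_right] at hmp ⊢
  set d : ℝ := p * n with hd
  set K : ℝ := N * DictLearn.specNorm (DictLearn.covMat P) with hK
  have hK0 : 0 ≤ K := mul_nonneg (Nat.cast_nonneg N) (norm_nonneg _)
  have hd0 : 0 < d := by linarith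
  have bound : ∀ b : ℝ, 0 ≤ b → 4 * (d * b) ≤ r ^ 2 → 2 * b * K ≤ σ ^ 2 →
      ENNReal.ofReal (d * b / 2) ≤ DictLearn.minimaxRisk N P σ D₀ r := by
    intro b hb h1 h2
    have h := DictLearn.ofReal_le_minimaxRisk (a := √b) N P hP2 hσ hD₀ hr hrp hp
    rw [Real.sq_sqrt hb] at h
    exact h h1 h2
  -- The best `b = a²` is the smaller of `r² / (4d)` and `σ² / (2K)`, each saturating one
  -- constraint. They give `r² / 8` and `σ² d / (4K)`, well above what is claimed.
  by_cases hcase : 2 * (r ^ 2 / (4 * d)) * K ≤ σ ^ 2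
  · refine le_trans ?_ (bound (r ^ 2 / (4 * d)) (by positivity) ?_ hcase)
    · refine (mul_le_mul_right (min_le_left _ _) _).trans ?_
      rw [← ENNReal.ofReal_mul (by norm_num)]
      refine ENNReal.ofReal_le_ofReal ?_
      have : d * (r ^ 2 / (4 * d)) / 2 = r ^ 2 / 8 := by field_simp; norm_num
      rw [this]
      nlinarith [sq_nonneg r]
    · exact le_of_eq (by field_simp)
  · push Not at hcase
    -- `K = 0` falls under the first case, so here the quotient in `[0, ∞]` is a real one.
    have hKpos : 0 < K := by
      rcases hK0.eq_or_lt with h | h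
      · rw [← h, mul_zero] at hcase
        nlinarith
      · exact h
    refine le_trans ?_ (bound (σ ^ 2 / (2 * K)) (by positivity) ?_ ?_)
    · refine (mul_le_mul_right (min_le_right _ _) _).trans ?_
      rw [← ENNReal.ofReal_div_of_pos hKpos, ← ENNReal.ofReal_mul (by positivity),
        ← ENNReal.ofReal_mul (by norm_num)]
      refine ENNReal.ofReal_le_ofReal ?_
      have h0 : 0 ≤ σ ^ 2 / K := by positivity
      have : d * (σ ^ 2 / (2 * K)) / 2 = σ ^ 2 / K * (d / 4) := by field_simp; norm_num
      rw [this]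
      nlinarith
    · have h1 : σ ^ 2 / (2 * K) ≤ r ^ 2 / (4 * d) := by
        rw [div_le_iff₀ (by positivity)]
        linarith
      calc 4 * (d * (σ ^ 2 / (2 * K))) ≤ 4 * (d * (r ^ 2 / (4 * d))) := by gcongr
        _ = r ^ 2 := by field_simp
    · exact le_of_eq (by field_simp)
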